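/- Let $R=\mathbb R[x,y,z]$ with its standard grading. For a homogeneous ideal $I\subseteq R$ let $I_d$ be its degree $d$ part and $HF(I,d)=\dim_{\mathbb R} I_d$. For each integer $r\ge 0$ put $$K(r)=\big((\langle x^{r+1},(x+y)^{r+1}\rangle\cap\langle z^{r+1},(z+y)^{r+1}\rangle):y^{r+1}\big)_r .$$ Let $\ell_{12}=x-y$, $\ell_{67}=x+y-2z$, $\ell_{23}=x+y-4z$, $\ell_{34}=x-y-2z$, $\ell_{26}=y-z$, and let $\epsilon=\epsilon(r)$ be the dimension of the degree $r$ part of $$\big(\langle \ell_{12}^{r+1},\ell_{67}^{r+1}\rangle:\ell_{26}^{r+1}\big)\cap\big(\langle \ell_{23}^{r+1},\ell_{34}^{r+1}\rangle:\ell_{26}^{r+1}\big).$$ Finally, let $(A_1,B_1,C_1)$ and $(D_1,E_1,F_1)$ be any two triples that generate the $R$-module of all $(s_0,s_1,s_2)\in R^3$ with $s_0x^{r+1}+s_1(x+y)^{r+1}+s_2y^{r+1}=0$, and let $(A_2,B_2,C_2)$ and $(D_2,E_2,F_2)$ be any two triples that generate the $R$-module of all $(s_0,s_1,s_2)\in R^3$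 with $s_0z^{r+1}+s_1(z+y)^{r+1}+s_2y^{r+1}=0$. Then $$\dim_{\mathbb R}K(r)=\epsilon(r)=HF\big(\langle C_1,F_1\rangle\cap\langle C_2,F_2\rangle,\,r\big)=\begin{cases} n, & \text{if } r=2n-1 \text{ with } n\ge 1,\\ n+1, & \text{if } r=2n \text{ with } n\ge 0.\end{cases}$$ -/

import Mathlib

namespace Spline

/-- The polynomial ring `ℝ[x, y, z]`. -/
abbrev R : Type := MvPolynomial (Fin 3) ℝ

noncomputable section

/-- The variable `x`. -/
abbrev x : R := MvPolynomial.X 0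

/-- The variable `y`. -/
abbrev y : R := MvPolynomial.X 1

/-- The variable `z`. -/
abbrev z : R := MvPolynomial.X 2

/-- The real vector space of the homogeneous elements of degree `d` in an ideal of `ℝ[x, y, z]`
(together with `0`). -/
def degreePart (I : Ideal R) (d : ℕ) : Submodule ℝ R :=
  I.restrictScalars ℝ ⊓ MvPolynomial.homogeneousSubmodule (Fin 3) ℝ d

/-- The Hilbert function of an ideal: the dimension over `ℝ` of its part of degree `d`. -/
def HF (I : Ideal R) (d : ℕ) : ℕ := Module.finrank ℝ (degreePart I d)

/-- `⟨a, b⟩ : c`, the ideal of all `g` with `g * c ∈ ⟨a, b⟩`. -/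
def pairColon (a b c : R) : Ideal R := (Ideal.span {a, b}).colon {c}

/-- `K(r)`, the degree `r` part of
`(⟨x^(r+1), (x+y)^(r+1)⟩ ∩ ⟨z^(r+1), (z+y)^(r+1)⟩) : y^(r+1)`. -/
def K (r : ℕ) : Submodule ℝ R :=
  degreePart
    ((Ideal.span {x ^ (r + 1), (x + y) ^ (r + 1)} ⊓
      Ideal.span {z ^ (r + 1), (z + y) ^ (r + 1)}).colon {y ^ (r + 1)}) r

/-- The linear forms of the interior edges of the triangulation of the plane by eight triangles,
indexed by the triangles that they separate. -/
def l12 : R := x - y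
/-- See `l12`. -/
def l23 : R := x + y - 4 * z
/-- See `l12`. -/
def l34 : R := x - y - 2 * z
/-- See `l12`. -/
def l67 : R := x + y - 2 * z
/-- See `l12`; this is the edge between the two interior vertices. -/
def l26 : R := y - z

/-- The number `ε`: the dimension of the degree `r` part of
`(⟨l12^(r+1), l67^(r+1)⟩ : l26^(r+1)) ∩ (⟨l23^(r+1), l34^(r+1)⟩ : l26^(r+1))`. -/
def epsilon (r : ℕ) : ℕ :=
  HF (pairColon (l12 ^ (r + 1)) (l67 ^ (r + 1)) (l26 ^ (r + 1)) ⊓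
    pairColon (l23 ^ (r + 1)) (l34 ^ (r + 1)) (l26 ^ (r + 1))) r

/-- The triples `u` and `v` generate the module of syzygies of `(a, b, c)`, that is, of all `s`
with `s₀ a + s₁ b + s₂ c = 0`. In particular this holds for the two columns of the matrix `ψ` in a
free resolution `0 → R² → R³ → R → R / ⟨a, b, c⟩ → 0` whose second map is given by `a, b, c`. -/
def GenerateSyzygies (a b c : R) (u v : Fin 3 → R) : Prop :=
  ∀ s : Fin 3 → R, s ∈ Submodule.span R {u, v} ↔ s 0 * a + s 1 * b + s 2 * c = 0

end

end Spline

/-! ### Univariate decomposition along powers of `X` and `X + 1`. -/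

namespace Polynomial

/-! `K r` is the intersection of `xColon r` and `zColon r` inside the space `S` of forms of degree
`r`. These two have equal dimension by the symmetry exchanging `x` and `z`, so two facts suffice:
`xColon r ⊕ ltSpan r = S` and `xColon r + zColon r = S`. Then dim `K r` = dim `S` - 2 dim `ltSpan
r`, the number of monomials of degree `r` with equal exponents of `x` and `z`, that is `r / 2 + 1`.

Both facts come from one univariate statement, applied to the coefficient of each `z ^ j` with `y =
1` and `m = r + 1`: a polynomial of degree less than `2 m - j` is uniquely `g + a X ^ m + b (X + 1)
^ m` with `deg g < j` and `deg a, deg b < m - j`. Uniqueness gives `xColon_disjoint_ltSpan`;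
existence gives `monomial_mem_xColon_sup`, from which both sums follow.

A linear change of coordinates identifies `ε` with dim `K r`, and third coordinates of generating
syzygies generate the colon ideal. -/

lemma eq_zero_of_iterate_derivative_eq_zero {p : ℝ[X]} {j : ℕ} (h : derivative^[j] p = 0)
    (hp : p = 0 ∨ j ≤ p.natDegree) : p = 0 := by
  rcases hp with hp | hp
  · exact hp
  have h1 : (derivative^[j] p).coeff (p.natDegree - j) = 0 := by rw [h, coeff_zero]
  rw [coeff_iterate_derivative, Nat.sub_add_cancel hp, smul_eq_zero] at h1
  rcases h1 with h1 | h1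
  · exact absurd h1 (Nat.descFactorial_eq_zero_iff_lt.not.mpr (by omega))
  · exact leadingCoeff_eq_zero.mp h1

/-- A relation `g + a X ^ m + b (X + 1) ^ m = 0` with `g`, `a`, `b` of small degree is trivial. -/
lemma eq_zero_of_add_mul_pow_add_mul_pow {m j : ℕ} (hj : j ≤ m) {g a b : ℝ[X]}
    (hg : g ∈ degreeLT ℝ j) (ha : a ∈ degreeLT ℝ (m - j)) (hb : b ∈ degreeLT ℝ (m - j))
    (h : g + a * X ^ m + b * (X + 1) ^ m = 0) : g = 0 ∧ a = 0 ∧ b = 0 := by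
  rw [mem_degreeLT] at hg ha hb
  have hX1 : (X + 1 : ℝ[X]).Monic := monic_X_add_C 1
  have hX1d : (X + 1 : ℝ[X]).natDegree = 1 := natDegree_X_add_C 1
  -- Differentiating `j` times kills `g` and leaves a common value, up to sign, divisible by both `X
  -- ^ (m - j)` and `(X + 1) ^ (m - j)`.
  have hD : derivative^[j] (a * X ^ m) + derivative^[j] (b * (X + 1) ^ m) = 0 := by
    have := congrArg (derivative^[j]) h
    rwa [iterate_map_add, iterate_map_add,
      iterate_derivative_eq_zero_of_degree_lt hg, zero_add, iterate_derivative_zero] at this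
  have h1 : X ^ (m - j) ∣ derivative^[j] (a * X ^ m) :=
    pow_sub_dvd_iterate_derivative_of_pow_dvd j (dvd_mul_left _ _)
  have h2 : (X + 1) ^ (m - j) ∣ derivative^[j] (b * (X + 1) ^ m) :=
    pow_sub_dvd_iterate_derivative_of_pow_dvd j (dvd_mul_left _ _)
  have h2' : (X + 1) ^ (m - j) ∣ derivative^[j] (a * X ^ m) := by
    rw [eq_neg_of_add_eq_zero_left hD]; exact h2.neg_right
  have hcop : IsCoprime ((X : ℝ[X]) ^ (m - j)) ((X + 1) ^ (m - j)) :=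
    IsCoprime.pow ⟨-1, 1, by ring⟩
  have hdvd := hcop.mul_dvd h1 h2'
  have hlt {p q : ℝ[X]} (hp0 : p ≠ 0) (hp : p.degree < (m - j : ℕ)) (hq : q.Monic)
      (hqd : q.natDegree = 1) : (p * q ^ m).natDegree = p.natDegree + m ∧
        p.natDegree < m - j := by
    refine ⟨?_, (natDegree_lt_iff_degree_lt hp0).mpr hp⟩
    rw [mul_comm, (hq.pow m).natDegree_mul' hp0, add_comm, hq.natDegree_pow, hqd, mul_one]
  -- The coprime divisors have total degree `2 (m - j)`, while the derivative has degree at most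
  -- `deg a + m - j`, which is smaller.
  have hz : derivative^[j] (a * X ^ m) = 0 := by
    by_contra hne
    have ha0 : a ≠ 0 := by rintro rfl; simp at hne
    obtain ⟨e1, e2⟩ := hlt ha0 ha monic_X natDegree_X
    have e3 := natDegree_le_of_dvd hdvd hne
    rw [(monic_X_pow _).natDegree_mul (hX1.pow _), hX1.natDegree_pow, natDegree_X_pow, hX1d] at e3
    have e4 := natDegree_iterate_derivative (a * X ^ m) j
    omega
  have hz' : derivative^[j] (b * (X + 1) ^ m) = 0 := by rwa [hz, zero_add] at hD
  have ha0 : a = 0 := by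
    by_contra hne
    obtain ⟨e1, e2⟩ := hlt hne ha monic_X natDegree_X
    have := eq_zero_of_iterate_derivative_eq_zero hz (Or.inr (by omega))
    simp [hne] at this
  have hb0 : b = 0 := by
    by_contra hne
    obtain ⟨e1, e2⟩ := hlt hne hb hX1 hX1d
    have := eq_zero_of_iterate_derivative_eq_zero hz' (Or.inr (by omega))
    simp [hne, hX1.ne_zero] at this
  refine ⟨?_, ha0, hb0⟩
  simpa [ha0, hb0] using h

lemma finrank_degreeLT (n : ℕ) : Module.finrank ℝ (degreeLT ℝ n) = n := by
  rw [(degreeLTEquiv ℝ n).finrank_eq, Module.finrank_fin_fun]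

instance finite_degreeLT (n : ℕ) : Module.Finite ℝ (degreeLT ℝ n) :=
  Module.Finite.equiv (degreeLTEquiv ℝ n).symm

/-- Every polynomial of degree less than `2 m - j` has the form `g + a X ^ m + b (X + 1) ^ m`
with `g`, `a`, `b` of small degree. -/
lemma exists_eq_add_mul_pow_add_mul_pow {m j : ℕ} (hj : j ≤ m) {p : ℝ[X]}
    (hp : p ∈ degreeLT ℝ (2 * m - j)) :
    ∃ g ∈ degreeLT ℝ j, ∃ a ∈ degreeLT ℝ (m - j), ∃ b ∈ degreeLT ℝ (m - j),
      p = g + a * X ^ m + b * (X + 1) ^ m := by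
  have hmul {q u : ℝ[X]} (hq : q ∈ degreeLT ℝ (m - j)) (hu : u.natDegree = 1) :
      q * u ^ m ∈ degreeLT ℝ (2 * m - j) := by
    rw [mem_degreeLT] at hq ⊢
    have hu0 : u ≠ 0 := by rintro rfl; simp at hu
    by_cases hq0 : q = 0
    · simp [hq0]
    rw [← natDegree_lt_iff_degree_lt hq0] at hq
    rw [← natDegree_lt_iff_degree_lt (mul_ne_zero hq0 (pow_ne_zero _ hu0)),
      natDegree_mul hq0 (pow_ne_zero _ hu0), natDegree_pow, hu]
    omega
  let T : (degreeLT ℝ j × degreeLT ℝ (m - j) × degreeLT ℝ (m - j)) →ₗ[ℝ]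
      degreeLT ℝ (2 * m - j) :=
    { toFun t := ⟨(t.1 : ℝ[X]) + (t.2.1 : ℝ[X]) * X ^ m + (t.2.2 : ℝ[X]) * (X + 1) ^ m,
        add_mem (add_mem (degreeLT_mono (by omega) t.1.2) (hmul t.2.1.2 natDegree_X))
          (hmul t.2.2.2 (natDegree_X_add_C 1))⟩
      map_add' s t := by ext1; simp only [Prod.fst_add, Prod.snd_add, Submodule.coe_add]; ring
      map_smul' c t := by
        ext1
        simp only [Prod.smul_fst, Prod.smul_snd, Submodule.coe_smul, RingHom.id_apply, smul_add,
          smul_mul_assoc] }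
  have hT : Function.Injective T := by
    rw [← LinearMap.ker_eq_bot, LinearMap.ker_eq_bot']
    intro t ht
    obtain ⟨h1, h2, h3⟩ := eq_zero_of_add_mul_pow_add_mul_pow hj t.1.2 t.2.1.2 t.2.2.2
      (congrArg Subtype.val ht)
    exact Prod.ext (Subtype.ext h1) (Prod.ext (Subtype.ext h2) (Subtype.ext h3))
  -- The dimensions agree: `j + 2 (m - j) = 2 m - j`.
  have hs : Function.Surjective T := by
    refine (LinearMap.injective_iff_surjective_of_finrank_eq_finrank ?_).mp hT
    simp only [Module.finrank_prod, finrank_degreeLT]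
    omega
  obtain ⟨t, ht⟩ := hs ⟨p, hp⟩
  exact ⟨_, t.1.2, _, t.2.1.2, _, t.2.2.2, (congrArg Subtype.val ht).symm⟩

end Polynomial

namespace Spline

open MvPolynomial

/-! ### Colon ideals and their graded parts. -/

lemma mem_pairColon {a b c f : R} : f ∈ pairColon a b c ↔ ∃ p q, p * a + q * b = f * c := by
  rw [pairColon, Submodule.mem_colon_singleton, smul_eq_mul, Ideal.mem_span_pair]

lemma mem_degreePart {I : Ideal R} {d : ℕ} {f : R} :
    f ∈ degreePart I d ↔ f ∈ I ∧ f.IsHomogeneous d := by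
  rw [degreePart, Submodule.mem_inf, Submodule.restrictScalars_mem, mem_homogeneousSubmodule]

lemma degreePart_le (I : Ideal R) (d : ℕ) : degreePart I d ≤ homogeneousSubmodule (Fin 3) ℝ d :=
  inf_le_right

lemma homogeneousComponent_mul_add {p q : R} {i j : ℕ} (hq : q.IsHomogeneous j) :
    homogeneousComponent (i + j) (p * q) = homogeneousComponent i p * q := by
  let := gradedAlgebra (σ := Fin 3) (R := ℝ)
  have := DirectSum.coe_decompose_mul_add_of_right_mem
    (homogeneousSubmodule (Fin 3) ℝ) (i := i) (a := p) hq
  rwa [← decomposition.decompose'_apply, ← decomposition.decompose'_apply]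

/-- For forms of equal degree, the coefficients in the definition of the colon ideal may be chosen
homogeneous. -/
lemma exists_isHomogeneous_of_mem_pairColon {a b c f : R} {m d : ℕ} (ha : a.IsHomogeneous m)
    (hb : b.IsHomogeneous m) (hc : c.IsHomogeneous m) (hf : f.IsHomogeneous d)
    (h : f ∈ pairColon a b c) :
    ∃ p q : R, p.IsHomogeneous d ∧ q.IsHomogeneous d ∧ p * a + q * b = f * c := by
  obtain ⟨p, q, h⟩ := mem_pairColon.mp h
  refine ⟨homogeneousComponent d p, homogeneousComponent d q,
    homogeneousComponent_isHomogeneous _ _, homogeneousComponent_isHomogeneous _ _, ?_⟩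
  have := congrArg (homogeneousComponent (d + m)) h
  rwa [map_add, homogeneousComponent_mul_add ha, homogeneousComponent_mul_add hb,
    homogeneousComponent_eq_self (hf.mul hc)] at this

/-! ### Dehomogenization, and independence of the colon space from `ltSpan`. -/

/-- Setting `y = 1`, as a polynomial in `z` with coefficients in `ℝ[x]`. -/
noncomputable def dehomogenize : R →ₐ[ℝ] Polynomial (Polynomial ℝ) :=
  aeval ![Polynomial.C Polynomial.X, 1, Polynomial.X]

lemma coeff_coeff_dehomogenize_monomial (s : Fin 3 →₀ ℕ) (c : ℝ) (i j : ℕ) :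
    ((dehomogenize (monomial s c)).coeff j).coeff i = if s 0 = i ∧ s 2 = j then c else 0 := by
  have : dehomogenize (monomial s c) =
      Polynomial.C (Polynomial.C c * Polynomial.X ^ s 0) * Polynomial.X ^ s 2 := by
    rw [dehomogenize, aeval_monomial, Finsupp.prod_fintype _ _ (by simp), Fin.prod_univ_three]
    simp [mul_assoc, IsScalarTower.algebraMap_apply ℝ (Polynomial ℝ) (Polynomial (Polynomial ℝ))]
  rw [this, Polynomial.coeff_C_mul_X_pow]
  by_cases h2 : j = s 2
  · rw [if_pos h2, Polynomial.coeff_C_mul_X_pow]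
    simp [h2, eq_comm]
  · rw [if_neg h2, if_neg (by tauto), Polynomial.coeff_zero]

lemma coeff_coeff_dehomogenize (f : R) (i j : ℕ) :
    ((dehomogenize f).coeff j).coeff i =
      ∑ s ∈ f.support, if s 0 = i ∧ s 2 = j then f.coeff s else 0 := by
  conv_lhs => rw [f.as_sum]
  simp only [map_sum, Polynomial.finsetSum_coeff, coeff_coeff_dehomogenize_monomial]

lemma degree_fin_three (s : Fin 3 →₀ ℕ) : s.degree = s 0 + s 1 + s 2 := by
  rw [Finsupp.degree_eq_sum, Fin.sum_univ_three]

lemma exponent_sum_eq {f : R} {d : ℕ} (hf : f.IsHomogeneous d) {s : Fin 3 →₀ ℕ}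
    (hs : s ∈ f.support) : s 0 + s 1 + s 2 = d := by
  rw [← degree_fin_three, hf.degree_eq_sum_deg_support hs]
  rfl

lemma eq_zero_of_dehomogenize {f : R} {d : ℕ} (hf : f.IsHomogeneous d)
    (h : dehomogenize f = 0) : f = 0 := by
  ext s
  rw [coeff_zero]
  by_contra hs
  have hs' : s ∈ f.support := mem_support_iff.mpr hs
  have h1 := coeff_coeff_dehomogenize f (s 0) (s 2)
  rw [Finset.sum_eq_single_of_mem s hs', if_pos ⟨rfl, rfl⟩, h] at h1
  · exact hs (by simpa using h1.symm)
  · intro t ht hts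
    refine if_neg fun h2 => hts ?_
    have e1 := exponent_sum_eq hf ht
    have e2 := exponent_sum_eq hf hs'
    ext k
    fin_cases k <;> simp <;> omega

lemma coeff_dehomogenize_mem_degreeLT {f : R} {d : ℕ} (hf : f.IsHomogeneous d)
    (j : ℕ) : (dehomogenize f).coeff j ∈ Polynomial.degreeLT ℝ (d + 1 - j) := by
  rw [Polynomial.mem_degreeLT, Polynomial.degree_lt_iff_coeff_zero]
  intro i hi
  rw [coeff_coeff_dehomogenize]
  refine Finset.sum_eq_zero fun s hs => if_neg fun h => ?_
  have := exponent_sum_eq hf hs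
  omega

/-- The span of the monomials `x ^ i * y ^ k * z ^ l` of degree `d` with `i < l`. -/
noncomputable def ltSpan (d : ℕ) : Submodule ℝ R :=
  restrictSupport ℝ {s : Fin 3 →₀ ℕ | s.degree = d ∧ s 0 < s 2}

lemma homogeneousSubmodule_eq_restrictSupport (d : ℕ) :
    homogeneousSubmodule (Fin 3) ℝ d = restrictSupport ℝ {s : Fin 3 →₀ ℕ | s.degree = d} :=
  homogeneousSubmodule_eq_finsupp_supported _ _ _

/-- The degree `r` part of `⟨x^(r+1), (x+y)^(r+1)⟩ : y^(r+1)`. -/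
noncomputable def xColon (r : ℕ) : Submodule ℝ R :=
  degreePart (pairColon (x ^ (r + 1)) ((x + y) ^ (r + 1)) (y ^ (r + 1))) r

/-- The degree `r` part of `⟨z^(r+1), (z+y)^(r+1)⟩ : y^(r+1)`. -/
noncomputable def zColon (r : ℕ) : Submodule ℝ R :=
  degreePart (pairColon (z ^ (r + 1)) ((z + y) ^ (r + 1)) (y ^ (r + 1))) r

lemma isHomogeneous_pow {l : R} (hl : l.IsHomogeneous 1) (m : ℕ) : (l ^ m).IsHomogeneous m := by
  simpa using hl.pow m

/-- With `y = 1`, the coefficient of `z ^ j` in an element of `ltSpan r` has degree less than `j` in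
`x`, so it can play the role of `g` in the univariate uniqueness statement. -/
lemma xColon_disjoint_ltSpan (r : ℕ) : Disjoint (xColon r) (ltSpan r) := by
  rw [Submodule.disjoint_def]
  intro f hf hlt
  obtain ⟨hf, hfr⟩ := mem_degreePart.mp hf
  obtain ⟨p, q, hp, hq, h⟩ := exists_isHomogeneous_of_mem_pairColon
    (isHomogeneous_pow (isHomogeneous_X _ _) _)
    (isHomogeneous_pow ((isHomogeneous_X _ _).add (isHomogeneous_X _ _)) _)
    (isHomogeneous_pow (isHomogeneous_X _ _) _) hfr hf
  refine eq_zero_of_dehomogenize hfr (Polynomial.ext fun j => ?_)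
  rw [Polynomial.coeff_zero]
  have hx : dehomogenize x = Polynomial.C Polynomial.X := by simp [dehomogenize]
  have hy : dehomogenize y = 1 := by simp [dehomogenize]
  have h' := congrArg (fun g => (dehomogenize g).coeff j) h
  simp only [map_add, map_mul, map_pow, hx, hy, one_pow, mul_one, Polynomial.coeff_add] at h'
  rw [← Polynomial.C_1, ← Polynomial.C_add, ← Polynomial.C_pow, ← Polynomial.C_pow,
    Polynomial.coeff_mul_C, Polynomial.coeff_mul_C] at h'
  have hfj := coeff_dehomogenize_mem_degreeLT hfr j
  by_cases hj : j ≤ r + 1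
  · refine (Polynomial.eq_zero_of_add_mul_pow_add_mul_pow hj
      (a := -(dehomogenize p).coeff j) (b := -(dehomogenize q).coeff j) ?_
      (neg_mem (coeff_dehomogenize_mem_degreeLT hp j))
      (neg_mem (coeff_dehomogenize_mem_degreeLT hq j)) ?_).1
    · rw [Polynomial.mem_degreeLT, Polynomial.degree_lt_iff_coeff_zero]
      intro i hi
      rw [coeff_coeff_dehomogenize]
      refine Finset.sum_eq_zero fun s hs => if_neg fun hs' => ?_
      have := (hlt hs).2
      omega
    · rw [← h']; ring
  -- For `j > r + 1` the form has no term in `z ^ j`: the degree bound truncates to `0`.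
  · rw [Nat.sub_eq_zero_of_le (by omega), Polynomial.mem_degreeLT] at hfj
    simpa using hfj

/-! ### Homogenization and reduction of monomials modulo the colon space. -/

lemma monomial_eq_C_mul (s : Fin 3 →₀ ℕ) (c : ℝ) :
    monomial s c = C c * (x ^ s 0 * y ^ s 1 * z ^ s 2) := by
  rw [monomial_eq, Finsupp.prod_fintype _ _ (by simp), Fin.prod_univ_three]

/-- The form of degree `n` in `x` and `y` that becomes `p` for `y = 1`. -/
noncomputable def homogenizeXY (n : ℕ) (p : Polynomial ℝ) : R :=
  aeval ![x, y] (p.homogenize n)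

lemma homogenizeXY_add (n : ℕ) (p q : Polynomial ℝ) :
    homogenizeXY n (p + q) = homogenizeXY n p + homogenizeXY n q := by
  simp [homogenizeXY]

lemma homogenizeXY_mul {m n : ℕ} {p q : Polynomial ℝ} (hp : p.natDegree ≤ m)
    (hq : q.natDegree ≤ n) :
    homogenizeXY (m + n) (p * q) = homogenizeXY m p * homogenizeXY n q := by
  simp [homogenizeXY, Polynomial.homogenize_mul _ _ hp hq]

lemma homogenizeXY_pow {p : Polynomial ℝ} (hp : p.natDegree ≤ 1) (m : ℕ) :
    homogenizeXY m (p ^ m) = homogenizeXY 1 p ^ m := by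
  induction m with
  | zero => simp [homogenizeXY]
  | succ m ih =>
    rw [pow_succ, homogenizeXY_mul (Polynomial.natDegree_pow_le_of_le m hp |>.trans (by simp)) hp,
      ih, pow_succ]

lemma homogenizeXY_one (n : ℕ) : homogenizeXY n 1 = y ^ n := by
  simp [homogenizeXY]

lemma homogenizeXY_X_pow {i n : ℕ} (h : i ≤ n) :
    homogenizeXY n (Polynomial.X ^ i) = x ^ i * y ^ (n - i) := by
  simp [homogenizeXY, Polynomial.homogenize_X_pow h]

lemma isHomogeneous_homogenizeXY (n : ℕ) (p : Polynomial ℝ) :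
    (homogenizeXY n p).IsHomogeneous n := by
  have := (Polynomial.isHomogeneous_homogenize (n := n) p).aeval (n := 1) (![x, y] : Fin 2 → R)
    (by intro i; fin_cases i <;> exact isHomogeneous_X _ _)
  rwa [one_mul] at this

lemma homogenizeXY_eq_sum (n : ℕ) (p : Polynomial ℝ) :
    homogenizeXY n p =
      ∑ kl ∈ Finset.HasAntidiagonal.antidiagonal n, C (p.coeff kl.1) * (x ^ kl.1 * y ^ kl.2) := by
  rw [homogenizeXY, Polynomial.homogenize, map_sum]
  refine Finset.sum_congr rfl fun kl _ => ?_
  rw [aeval_monomial, Finsupp.prod_fintype _ _ (by simp), Fin.prod_univ_two]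
  simp

/-- Modulo the colon ideal, a monomial `x ^ i * y ^ k * z ^ l` with `l ≤ i` is a combination of
monomials with the same exponent `l` of `z` and exponent of `x` less than `l`. -/
lemma monomial_mem_xColon_sup {r : ℕ} {s : Fin 3 →₀ ℕ} (hs : s.degree = r) (h : s 2 ≤ s 0) :
    monomial s 1 ∈ xColon r ⊔
      restrictSupport ℝ {t : Fin 3 →₀ ℕ | t.degree = r ∧ t 0 < s 2 ∧ t 2 = s 2} := by
  have hs3 := degree_fin_three s
  set N := s 0 + s 1 with hN
  obtain ⟨g, hg, a, ha, b, hb, hgab⟩ := Polynomial.exists_eq_add_mul_pow_add_mul_pow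
    (m := r + 1) (j := s 2) (by omega) (p := Polynomial.X ^ s 0)
    (Polynomial.mem_degreeLT.mpr (by rw [Polynomial.degree_X_pow]; exact_mod_cast (by omega)))
  have hdeg {p : Polynomial ℝ} {k : ℕ} (hp : p ∈ Polynomial.degreeLT ℝ k) (hk : k ≤ N + 1) :
      p.natDegree ≤ N := by
    rw [Polynomial.natDegree_le_iff_degree_le, ← Polynomial.mem_degreeLE,
      ← Polynomial.degreeLT_succ_eq_degreeLE]
    exact Polynomial.degreeLT_mono hk hp
  have hX1 : homogenizeXY 1 (Polynomial.X + 1) = x + y := by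
    have := homogenizeXY_X_pow (le_refl 1)
    rw [pow_one, pow_one, Nat.sub_self, pow_zero, mul_one] at this
    rw [homogenizeXY_add, this, homogenizeXY_one, pow_one]
  have hX1d : (Polynomial.X + 1 : Polynomial ℝ).natDegree ≤ 1 :=
    (Polynomial.natDegree_X_add_C (1 : ℝ)).le
  have key := congrArg (homogenizeXY (N + (r + 1))) hgab
  -- The factor `1` beside `g` homogenizes to `y ^ (r + 1)`, so that `key` becomes a colon relation.
  rw [← mul_one g, homogenizeXY_add, homogenizeXY_add, homogenizeXY_X_pow (by omega),
    homogenizeXY_mul (hdeg hg (by omega)) (by simp),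
    homogenizeXY_mul (hdeg ha (by omega)) (by simp),
    homogenizeXY_mul (hdeg hb (by omega))
      (Polynomial.natDegree_pow_le_of_le _ hX1d |>.trans (by simp)),
    homogenizeXY_one, homogenizeXY_X_pow le_rfl,
    homogenizeXY_pow hX1d, hX1, Nat.sub_self, pow_zero,
    mul_one, show N + (r + 1) - s 0 = s 1 + (r + 1) by omega, pow_add] at key
  have hz : (z ^ s 2).IsHomogeneous (s 2) := isHomogeneous_pow (isHomogeneous_X _ _) _
  have hhom (p : Polynomial ℝ) : (homogenizeXY N p * z ^ s 2).IsHomogeneous r := by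
    have := (isHomogeneous_homogenizeXY N p).mul hz
    rwa [show N + s 2 = r by omega] at this
  rw [← sub_add_cancel (monomial s (1 : ℝ)) (homogenizeXY N g * z ^ s 2)]
  refine Submodule.add_mem_sup ?_ ?_
  · refine mem_degreePart.mpr ⟨mem_pairColon.mpr
      ⟨homogenizeXY N a * z ^ s 2, homogenizeXY N b * z ^ s 2, ?_⟩,
      (isHomogeneous_monomial _ hs).sub (hhom g)⟩
    rw [monomial_eq_C_mul, C_1]
    linear_combination -(z ^ s 2) * key
  · rw [homogenizeXY_eq_sum, Finset.sum_mul]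
    refine sum_mem fun kl hkl => ?_
    rw [Finset.HasAntidiagonal.mem_antidiagonal] at hkl
    by_cases hk : kl.1 < s 2
    · let t : Fin 3 →₀ ℕ := Finsupp.equivFunOnFinite.symm ![kl.1, kl.2, s 2]
      have ht : C (g.coeff kl.1) * (x ^ kl.1 * y ^ kl.2) * z ^ s 2 =
          monomial t (g.coeff kl.1) := by
        rw [monomial_eq_C_mul, mul_assoc]; rfl
      rw [ht, monomial_mem_restrictSupport]
      refine Or.inl ⟨?_, hk, rfl⟩
      rw [degree_fin_three]
      change kl.1 + kl.2 + s 2 = r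
      omega
    · rw [Polynomial.mem_degreeLT, Polynomial.degree_lt_iff_coeff_zero] at hg
      rw [hg _ (by omega), C_0, zero_mul, zero_mul]
      exact zero_mem _

lemma restrictSupport_le_iff {s : Set (Fin 3 →₀ ℕ)} {M : Submodule ℝ R} :
    restrictSupport ℝ s ≤ M ↔ ∀ t ∈ s, monomial t 1 ∈ M := by
  rw [restrictSupport_eq_span, Submodule.span_le, Set.image_subset_iff]
  rfl

lemma ltSpan_le (r : ℕ) : ltSpan r ≤ homogeneousSubmodule (Fin 3) ℝ r := by
  rw [homogeneousSubmodule_eq_restrictSupport]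
  exact restrictSupport_mono _ fun _ h => h.1

lemma xColon_sup_ltSpan (r : ℕ) : xColon r ⊔ ltSpan r = homogeneousSubmodule (Fin 3) ℝ r := by
  refine le_antisymm (sup_le (degreePart_le _ _) (ltSpan_le r)) ?_
  rw [homogeneousSubmodule_eq_restrictSupport, restrictSupport_le_iff]
  intro s hs
  rcases lt_or_ge (s 0) (s 2) with h | h
  · exact Submodule.mem_sup_right (monomial_mem_restrictSupport _ |>.mpr (Or.inl ⟨hs, h⟩))
  · refine sup_le_sup_left (α := Submodule ℝ R) (restrictSupport_mono _ ?_) _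
      (monomial_mem_xColon_sup hs h)
    rintro t ⟨h1, h2, h3⟩
    exact ⟨h1, by omega⟩

/-! ### Linear automorphisms and the symmetry between `x` and `z`. -/

lemma degreePart_map_eq {I J : Ideal R} (e : R ≃ₐ[ℝ] R) (d : ℕ)
    (hI : ∀ f, f ∈ I ↔ e f ∈ J)
    (he : ∀ i, (e (X i)).IsHomogeneous 1) (he' : ∀ i, (e.symm (X i)).IsHomogeneous 1) :
    (degreePart I d).map e.toLinearMap = degreePart J d := by
  have hom (g : R →ₐ[ℝ] R) (hg : ∀ i, (g (X i)).IsHomogeneous 1) {f : R}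
      (hf : f.IsHomogeneous d) : (g f).IsHomogeneous d := by
    have := hf.aeval (fun i => g (X i)) hg
    rwa [one_mul, show (fun i => g (X i)) = g ∘ X from rfl, ← aeval_unique g] at this
  ext f
  rw [Submodule.mem_map]
  constructor
  · rintro ⟨g, hg, rfl⟩
    rw [mem_degreePart] at hg ⊢
    exact ⟨(hI g).mp hg.1, hom e he hg.2⟩
  · intro hf
    rw [mem_degreePart] at hf
    refine ⟨e.symm f, mem_degreePart.mpr ⟨?_, hom e.symm he' hf.2⟩, e.apply_symm_apply f⟩
    rw [hI, e.apply_symm_apply]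
    exact hf.1

lemma mem_pairColon_map_iff (e : R ≃ₐ[ℝ] R) {a b c f : R} :
    f ∈ pairColon a b c ↔ e f ∈ pairColon (e a) (e b) (e c) := by
  rw [mem_pairColon, mem_pairColon]
  constructor
  · rintro ⟨p, q, h⟩
    exact ⟨e p, e q, by rw [← map_mul, ← map_mul, ← map_add, h, map_mul]⟩
  · rintro ⟨p, q, h⟩
    refine ⟨e.symm p, e.symm q, e.injective ?_⟩
    simpa using h

/-- The automorphism that exchanges `x` and `z`. -/
noncomputable def swapXZ : R ≃ₐ[ℝ] R := renameEquiv ℝ (Equiv.swap 0 2)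

lemma swapXZ_x : swapXZ x = z := by simp [swapXZ]

lemma swapXZ_y : swapXZ y = y := by
  simp [swapXZ, Equiv.swap_apply_of_ne_of_ne]

lemma swapXZ_z : swapXZ z = x := by simp [swapXZ]

lemma map_swapXZ_xColon (r : ℕ) : (xColon r).map swapXZ.toLinearMap = zColon r := by
  refine degreePart_map_eq swapXZ r (fun f => ?_) ?_ ?_
  · rw [mem_pairColon_map_iff swapXZ]
    simp only [map_pow, map_add, swapXZ_x, swapXZ_y]
  · intro i
    simpa [swapXZ] using isHomogeneous_X _ _
  · intro i
    simpa [swapXZ] using isHomogeneous_X _ _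

lemma swapXZ_monomial (s : Fin 3 →₀ ℕ) :
    ∃ t : Fin 3 →₀ ℕ, swapXZ (monomial s 1) = monomial t 1 ∧ t 0 = s 2 ∧ t 1 = s 1 ∧
      t 2 = s 0 := by
  refine ⟨Finsupp.equivFunOnFinite.symm ![s 2, s 1, s 0], ?_, rfl, rfl, rfl⟩
  rw [monomial_eq_C_mul, monomial_eq_C_mul]
  simp only [map_mul, map_pow, swapXZ_x, swapXZ_y, swapXZ_z, map_one, one_mul]
  change _ = x ^ s 2 * y ^ s 1 * z ^ s 0
  ring

lemma map_swapXZ_restrictSupport {S T : Set (Fin 3 →₀ ℕ)}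
    (h : ∀ s t : Fin 3 →₀ ℕ, t 0 = s 2 → t 1 = s 1 → t 2 = s 0 → s ∈ S → t ∈ T) :
    (restrictSupport ℝ S).map swapXZ.toLinearMap ≤ restrictSupport ℝ T := by
  rw [Submodule.map_le_iff_le_comap, restrictSupport_le_iff]
  intro s hs
  obtain ⟨t, e, h0, h1, h2⟩ := swapXZ_monomial s
  rw [Submodule.mem_comap]
  change swapXZ (monomial s 1) ∈ restrictSupport ℝ T
  rw [e, monomial_mem_restrictSupport]
  exact Or.inl (h s t h0 h1 h2 hs)

lemma monomial_mem_zColon_sup {r : ℕ} {s : Fin 3 →₀ ℕ} (hs : s.degree = r) (h : s 0 ≤ s 2) :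
    monomial s 1 ∈ zColon r ⊔
      restrictSupport ℝ {t : Fin 3 →₀ ℕ | t.degree = r ∧ t 2 < s 0 ∧ t 0 = s 0} := by
  obtain ⟨t, e, h0, h1, h2⟩ := swapXZ_monomial s
  have hinv : swapXZ (monomial t 1) = monomial s 1 := by
    rw [← e]
    exact (renameEquiv ℝ (Equiv.swap (0 : Fin 3) 2)).symm_apply_apply _
  have := Submodule.mem_map_of_mem (f := swapXZ.toLinearMap)
    (monomial_mem_xColon_sup (r := r) (s := t)
      (by rw [degree_fin_three] at hs ⊢; omega) (by omega))
  rw [Submodule.map_sup, map_swapXZ_xColon] at this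
  rw [← hinv]
  refine sup_le_sup_left (map_swapXZ_restrictSupport ?_) _ this
  rintro u v e0 e1 e2 ⟨d1, d2, d3⟩
  refine ⟨?_, ?_, ?_⟩
  · rw [degree_fin_three] at d1 ⊢; omega
  · omega
  · omega

/-- Reducing the larger of the exponents of `x` and `z` below the other one, which stays fixed,
strictly lowers their sum; the induction is on that sum. -/
lemma xColon_sup_zColon (r : ℕ) : xColon r ⊔ zColon r = homogeneousSubmodule (Fin 3) ℝ r := by
  refine le_antisymm (sup_le (degreePart_le _ _) (degreePart_le _ _)) ?_
  rw [homogeneousSubmodule_eq_restrictSupport, restrictSupport_le_iff]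
  intro s hs
  induction hn : s 0 + s 2 using Nat.strong_induction_on generalizing s with
  | _ n ih =>
    rcases le_total (s 2) (s 0) with h | h
    · refine (sup_le (α := Submodule ℝ R) le_sup_left ?_) (monomial_mem_xColon_sup hs h)
      rw [restrictSupport_le_iff]
      rintro t ⟨h1, h2, h3⟩
      exact ih _ (by omega) t h1 rfl
    · refine (sup_le (α := Submodule ℝ R) le_sup_right ?_) (monomial_mem_zColon_sup hs h)
      rw [restrictSupport_le_iff]
      rintro t ⟨h1, h2, h3⟩
      exact ih _ (by omega) t h1 rfl

/-! ### Dimension count. -/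

lemma finrank_restrictSupport (S : Set (Fin 3 →₀ ℕ)) :
    Module.finrank ℝ (restrictSupport ℝ S) = S.ncard := by
  rw [Module.finrank_eq_nat_card_basis (basisRestrictSupport ℝ S), Nat.card_coe_set_eq]

instance finite_homogeneousSubmodule (r : ℕ) :
    Module.Finite ℝ (homogeneousSubmodule (Fin 3) ℝ r) :=
  Module.Finite.iff_fg.mpr (homogeneousSubmodule_fg _ _ r)

lemma finite_setOf_degree_eq (r : ℕ) : {s : Fin 3 →₀ ℕ | s.degree = r}.Finite := by
  refine Set.Finite.subset (Set.finite_Iic (Finsupp.equivFunOnFinite.symm fun _ : Fin 3 => r))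
    fun s hs k => ?_
  have := degree_fin_three s
  change s.degree = r at hs
  change s k ≤ r
  fin_cases k <;> simp <;> omega

lemma ncard_setOf_degree_eq (r : ℕ) :
    {s : Fin 3 →₀ ℕ | s.degree = r}.ncard =
      2 * {s : Fin 3 →₀ ℕ | s.degree = r ∧ s 0 < s 2}.ncard + (r / 2 + 1) := by
  have hfin (P : (Fin 3 →₀ ℕ) → Prop) : {s : Fin 3 →₀ ℕ | s.degree = r ∧ P s}.Finite :=
    (finite_setOf_degree_eq r).subset fun _ h => h.1
  have hgt : {s : Fin 3 →₀ ℕ | s.degree = r ∧ s 2 < s 0}.ncard =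
      {s : Fin 3 →₀ ℕ | s.degree = r ∧ s 0 < s 2}.ncard := by
    let e : (Fin 3 →₀ ℕ) → (Fin 3 →₀ ℕ) := fun s =>
      Finsupp.equivFunOnFinite.symm ![s 2, s 1, s 0]
    have he (s : Fin 3 →₀ ℕ) : (e s).degree = s.degree := by
      rw [degree_fin_three, degree_fin_three]
      change s 2 + s 1 + s 0 = _
      ring
    have hee (s : Fin 3 →₀ ℕ) : e (e s) = s := by
      ext k
      fin_cases k <;> rfl
    refine Set.ncard_congr (fun s _ => e s) ?_ ?_ ?_
    · rintro s ⟨h1, h2⟩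
      exact ⟨(he s).trans h1, h2⟩
    · intro s t _ _ h
      rw [← hee s, h, hee]
    · rintro s ⟨h1, h2⟩
      exact ⟨e s, ⟨(he s).trans h1, h2⟩, hee s⟩
  have heq : {s : Fin 3 →₀ ℕ | s.degree = r ∧ s 0 = s 2}.ncard = r / 2 + 1 := by
    let f : ℕ → (Fin 3 →₀ ℕ) := fun i => Finsupp.equivFunOnFinite.symm ![i, r - 2 * i, i]
    have hf : Function.Injective f := fun i j h => DFunLike.congr_fun h 0
    have : {s : Fin 3 →₀ ℕ | s.degree = r ∧ s 0 = s 2} = f '' (Finset.range (r / 2 + 1)) := by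
      ext s
      simp only [Set.mem_ofPred_eq, Set.mem_image, Finset.coe_range, Set.mem_Iio]
      constructor
      · rintro ⟨h1, h2⟩
        rw [degree_fin_three] at h1
        refine ⟨s 0, by omega, ?_⟩
        ext k
        fin_cases k
        · rfl
        · change r - 2 * s 0 = s 1
          omega
        · exact h2
      · rintro ⟨i, hi, rfl⟩
        refine ⟨?_, rfl⟩
        rw [degree_fin_three]
        change i + (r - 2 * i) + i = r
        omega
    rw [this, Set.ncard_image_of_injective _ hf, Set.ncard_coe_finset, Finset.card_range]
  have hsplit : {s : Fin 3 →₀ ℕ | s.degree = r} =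
      ({s | s.degree = r ∧ s 0 < s 2} ∪ {s | s.degree = r ∧ s 2 < s 0}) ∪
        {s | s.degree = r ∧ s 0 = s 2} := by
    ext s
    simp only [Set.mem_union, Set.mem_ofPred_eq]
    have := lt_trichotomy (s 0) (s 2)
    tauto
  rw [hsplit, Set.ncard_union_eq _ ((hfin _).union (hfin _)) (hfin _),
    Set.ncard_union_eq _ (hfin _) (hfin _), hgt, heq, two_mul]
  · rw [Set.disjoint_left]; rintro s ⟨_, h1⟩ ⟨_, h2⟩; omega
  · rw [Set.disjoint_left]; rintro s (⟨_, h1⟩ | ⟨_, h1⟩) ⟨_, h2⟩ <;> omega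

lemma finrank_xColon_inf_zColon (r : ℕ) :
    Module.finrank ℝ (xColon r ⊓ zColon r : Submodule ℝ R) = r / 2 + 1 := by
  have hx : Module.Finite ℝ (xColon r) := Submodule.finiteDimensional_of_le (degreePart_le _ _)
  have hz : Module.Finite ℝ (zColon r) := Submodule.finiteDimensional_of_le (degreePart_le _ _)
  have hl : Module.Finite ℝ (ltSpan r) := Submodule.finiteDimensional_of_le (ltSpan_le r)
  have h1 : Module.finrank ℝ (homogeneousSubmodule (Fin 3) ℝ r) =
      Module.finrank ℝ (xColon r) + Module.finrank ℝ (ltSpan r) := by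
    have := Submodule.finrank_sup_add_finrank_inf_eq (xColon r) (ltSpan r)
    rwa [xColon_sup_ltSpan, (xColon_disjoint_ltSpan r).eq_bot, finrank_bot, add_zero] at this
  have h2 : Module.finrank ℝ (homogeneousSubmodule (Fin 3) ℝ r) +
      Module.finrank ℝ (xColon r ⊓ zColon r : Submodule ℝ R) =
      Module.finrank ℝ (xColon r) + Module.finrank ℝ (zColon r) := by
    have := Submodule.finrank_sup_add_finrank_inf_eq (xColon r) (zColon r)
    rwa [xColon_sup_zColon] at this
  have h3 : Module.finrank ℝ (zColon r) = Module.finrank ℝ (xColon r) := by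
    rw [← map_swapXZ_xColon]
    exact (Submodule.equivMapOfInjective _ swapXZ.injective _).finrank_eq.symm
  have h4 : Module.finrank ℝ (homogeneousSubmodule (Fin 3) ℝ r) =
      2 * Module.finrank ℝ (ltSpan r) + (r / 2 + 1) := by
    rw [homogeneousSubmodule_eq_restrictSupport, ltSpan, finrank_restrictSupport,
      finrank_restrictSupport, ncard_setOf_degree_eq]
  omega

/-! ### Identification of `K`, the syzygy ideals and `ε`. -/

lemma degreePart_inf (I J : Ideal R) (d : ℕ) :
    degreePart (I ⊓ J) d = degreePart I d ⊓ degreePart J d := by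
  ext f
  simp only [mem_degreePart, Submodule.mem_inf]
  tauto

lemma K_eq (r : ℕ) : K r = xColon r ⊓ zColon r := by
  rw [xColon, zColon, ← degreePart_inf, K]
  congr 1
  ext f
  simp only [pairColon, Submodule.mem_inf, Submodule.mem_colon_singleton]

/-- A multiplier `f` lies in the colon ideal exactly when it is the third coordinate of some syzygy.
-/
lemma span_pair_eq_pairColon {a b c A B C D E F : R}
    (h : GenerateSyzygies a b c ![A, B, C] ![D, E, F]) :
    Ideal.span {C, F} = pairColon a b c := by
  ext f
  rw [mem_pairColon, Ideal.mem_span_pair]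
  constructor
  · rintro ⟨p, q, rfl⟩
    have := (h (p • ![A, B, C] + q • ![D, E, F])).mp
      (Submodule.mem_span_pair.mpr ⟨p, q, rfl⟩)
    refine ⟨-(p * A + q * D), -(p * B + q * E), ?_⟩
    simp at this
    linear_combination -this
  · rintro ⟨p, q, hpq⟩
    obtain ⟨u, v, huv⟩ := Submodule.mem_span_pair.mp ((h ![-p, -q, f]).mpr (by
      simp; linear_combination -hpq))
    exact ⟨u, v, by simpa using congrFun huv 2⟩

lemma pairColon_comm (a b c : R) : pairColon a b c = pairColon b a c := by
  rw [pairColon, pairColon, Set.pair_comm]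

lemma pairColon_mul_of_isUnit {a b c u : R} (hu : IsUnit u) :
    pairColon a b (u * c) = pairColon a b c := by
  ext f
  rw [pairColon, pairColon, Submodule.mem_colon_singleton, Submodule.mem_colon_singleton,
    smul_eq_mul, smul_eq_mul, mul_left_comm, Ideal.unit_mul_mem_iff_mem _ hu]

lemma C_half_mul_two : (C (1 / 2) * 2 : R) = 1 := by
  rw [← map_ofNat (C : ℝ →+* R) 2, ← C_mul]
  norm_num

/-- The linear change of coordinates that takes `x`, `x + y`, `z + y`, `z` to `l12`, `l67`, `l23`,
`l34`, and `y` to `2 * l26`. -/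
noncomputable def coordChange : R ≃ₐ[ℝ] R :=
  AlgEquiv.ofAlgHom
    (aeval ![l12, 2 * l26, l34])
    (aeval ![x + C (1 / 2) * (y + x - z), C (1 / 2) * (y + x - z), C (1 / 2) * (x - z)])
    (by
      have h := C_half_mul_two
      refine algHom_ext fun i => ?_
      fin_cases i <;>
        simp only [AlgHom.comp_apply, aeval_X, AlgHom.id_apply, map_add, map_sub, map_mul,
          algHom_C, algebraMap_eq, l12, l26, l34, Fin.zero_eta, Fin.mk_one, Fin.reduceFinMk,
          Matrix.cons_val]
      · linear_combination y * h
      · linear_combination y * h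
      · linear_combination z * h)
    (by
      have h := C_half_mul_two
      refine algHom_ext fun i => ?_
      fin_cases i <;>
        simp only [AlgHom.comp_apply, aeval_X, AlgHom.id_apply, map_sub, map_mul,
          map_ofNat, l12, l26, l34, Fin.zero_eta, Fin.mk_one, Fin.reduceFinMk,
          Matrix.cons_val]
      · ring
      · linear_combination y * h
      · linear_combination (z - x) * h)

lemma coordChange_x : coordChange x = l12 := by simp [coordChange]

lemma coordChange_y : coordChange y = 2 * l26 := by simp [coordChange]

lemma coordChange_z : coordChange z = l34 := by simp [coordChange]

lemma isHomogeneous_coordChange_X (i : Fin 3) : (coordChange (X i)).IsHomogeneous 1 := by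
  have hX (i : Fin 3) : (X i : R).IsHomogeneous 1 := isHomogeneous_X _ _
  have h2 {f : R} (hf : f.IsHomogeneous 1) : (2 * f).IsHomogeneous 1 := by
    rw [← map_ofNat (C : ℝ →+* R) 2]
    exact hf.C_mul _
  fin_cases i
  · exact coordChange_x ▸ (hX 0).sub (hX 1)
  · exact coordChange_y ▸ h2 ((hX 1).sub (hX 2))
  · exact coordChange_z ▸ ((hX 0).sub (hX 1)).sub (h2 (hX 2))

lemma isHomogeneous_coordChange_symm_X (i : Fin 3) :
    (coordChange.symm (X i)).IsHomogeneous 1 := by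
  have hX (i : Fin 3) : (X i : R).IsHomogeneous 1 := isHomogeneous_X _ _
  have hy := (((hX 1).add (hX 0)).sub (hX 2)).C_mul (1 / 2)
  have : coordChange.symm (X i) =
      ![x + C (1 / 2) * (y + x - z), C (1 / 2) * (y + x - z), C (1 / 2) * (x - z)] i :=
    aeval_X _ i
  rw [this]
  fin_cases i
  · exact (hX 0).add hy
  · exact hy
  · exact ((hX 0).sub (hX 2)).C_mul (1 / 2)

lemma epsilon_eq (r : ℕ) : epsilon r = Module.finrank ℝ (K r) := by
  -- `y` goes to `2 * l26`; the factor `2 ^ (r + 1)` does not affect the colon ideal.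
  have hu : IsUnit ((2 : R) ^ (r + 1)) :=
    (IsUnit.of_mul_eq_one (C (1 / 2)) (by rw [mul_comm, C_half_mul_two])).pow _
  have h67 : coordChange (x + y) = l67 := by
    rw [map_add, coordChange_x, coordChange_y, l12, l26, l67]
    ring
  have h23 : coordChange (z + y) = l23 := by
    rw [map_add, coordChange_z, coordChange_y, l34, l26, l23]
    ring
  rw [K_eq, xColon, zColon, ← degreePart_inf, epsilon, HF, ← degreePart_map_eq coordChange r _
    isHomogeneous_coordChange_X isHomogeneous_coordChange_symm_X]
  · exact (Submodule.equivMapOfInjective _ coordChange.injective _).finrank_eq.symm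
  · intro f
    rw [Submodule.mem_inf, Submodule.mem_inf, mem_pairColon_map_iff coordChange,
      mem_pairColon_map_iff coordChange (a := z ^ (r + 1)), map_pow, map_pow, map_pow, map_pow,
      map_pow, h67, h23, coordChange_x, coordChange_y, coordChange_z, mul_pow,
      pairColon_mul_of_isUnit hu, pairColon_mul_of_isUnit hu, pairColon_comm (l34 ^ (r + 1))]

end Spline

open Spline in
theorem theorem1p2 (r n d : ℕ) (h : (r + 1 = 2 * n ∧ d = n) ∨ (r = 2 * n ∧ d = n + 1)) :
    Module.finrank ℝ (K r) = d ∧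
    epsilon r = d ∧
    ∀ A₁ B₁ C₁ D₁ E₁ F₁ A₂ B₂ C₂ D₂ E₂ F₂ : R,
      GenerateSyzygies (x ^ (r + 1)) ((x + y) ^ (r + 1)) (y ^ (r + 1))
        ![A₁, B₁, C₁] ![D₁, E₁, F₁] →
      GenerateSyzygies (z ^ (r + 1)) ((z + y) ^ (r + 1)) (y ^ (r + 1))
        ![A₂, B₂, C₂] ![D₂, E₂, F₂] →
      HF (Ideal.span {C₁, F₁} ⊓ Ideal.span {C₂, F₂}) r = d := by
  have hd : d = r / 2 + 1 := by omega
  have hK : Module.finrank ℝ (K r) = d := by rw [K_eq, finrank_xColon_inf_zColon, hd]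
  refine ⟨hK, (epsilon_eq r).trans hK, ?_⟩
  intro A₁ B₁ C₁ D₁ E₁ F₁ A₂ B₂ C₂ D₂ E₂ F₂ h₁ h₂
  rw [span_pair_eq_pairColon h₁, span_pair_eq_pairColon h₂, HF, degreePart_inf, ← hK, K_eq]
  rfl
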